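/- Let $N,n\ge 1$ and let $(Y_i)_{i\ge 1}$ be a stationary reversible Markov chain with state space $[N]=\{1,\dots,N\}$, transition matrix $A$ and stationary probability measure $\mu$; that is, $A$ is a stochastic matrix with $\mu_iA_{ij}=\mu_jA_{ji}$ for all $i,j$, and $Y_1$ is distributed according to $\mu$. Let $(E_\mu)_{ij}=\mu_j$, let $\|v\|_{L_2(\mu)}=\big(\sum_{i=1}^N|v_i|^2\mu_i\big)^{1/2}$ for $v\in\mathbb R^N$, and put $$\lambda=\|A-E_\mu\|_{L_2(\mu)\to L_2(\mu)}=\max_{v\in\mathbb R^N:\ \|v\|_{L_2(\mu)}=1}\|(A-E_\mu)v\|_{L_2(\mu)}.$$ Assume $\lambda<1$ (one always has $\lambda\le 1$, and the bound below is void for $\lambda=1$). Let $f_1,\dots,f_n:[N]\to\{-1,1\}$ satisfy $\mathbb E[f_i(Y_i)]=0$ for every $i$. Then for all distinct integers $v_1,\dots,v_n\ge 1$ and every $x_0\in\mathbb Z$, $$\Pr\big[f_1(Y_1)v_1+f_2(Y_2)v_2+\cdots+f_n(Y_n)v_n=x_0\big]\le\frac{C}{(1-\lambda)^3\,n^{3/2}},$$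 where $C>0$ is a universal constant (independent of $n$, $N$, the chain, the $f_i$, the $v_i$ and $x_0$). -/

import Mathlib

/-- The norm `‖v‖_{L₂(μ)} = (∑ i, |v i| ^ 2 * μ i) ^ (1 / 2)` of a vector `v ∈ ℝ^N`. -/
noncomputable def L2norm {N : ℕ} (μ v : Fin N → ℝ) : ℝ :=
  Real.sqrt (∑ i, |v i| ^ 2 * μ i)

/-- The operator norm `‖M‖_{L₂(μ) → L₂(μ)}`, the supremum of `‖M v‖_{L₂(μ)}` over all
vectors `v ∈ ℝ^N` with `‖v‖_{L₂(μ)} = 1`. -/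
noncomputable def L2opNorm {N : ℕ} (μ : Fin N → ℝ) (M : Matrix (Fin N) (Fin N) ℝ) : ℝ :=
  sSup {r : ℝ | ∃ v : Fin N → ℝ, L2norm μ v = 1 ∧ r = L2norm μ (M.mulVec v)}

/-- The averaging operator `(E_μ)_{ij} = μ_j`. -/
def averagingOp {N : ℕ} (μ : Fin N → ℝ) : Matrix (Fin N) (Fin N) ℝ :=
  Matrix.of fun _ j => μ j

/-- The quantity `λ = ‖A - E_μ‖_{L₂(μ) → L₂(μ)}`. -/
noncomputable def chainLambda {N : ℕ} (A : Matrix (Fin N) (Fin N) ℝ) (μ : Fin N → ℝ) : ℝ :=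
  L2opNorm μ (A - averagingOp μ)

/-- `Y 0, Y 1, …` is a stationary reversible Markov chain on the probability space `(Ω, P)`
with state space `Fin N`, transition matrix `A` and stationary probability vector `μ`. -/
structure IsStationaryReversibleMarkovChain {N : ℕ} {Ω : Type*} [MeasurableSpace Ω]
    (P : MeasureTheory.Measure Ω) (A : Matrix (Fin N) (Fin N) ℝ) (μ : Fin N → ℝ)
    (Y : ℕ → Ω → Fin N) : Prop where
  /-- The transition probabilities are nonnegative. -/
  transition_nonneg : ∀ i j, 0 ≤ A i j
  /-- The rows of the transition matrix sum to one. -/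
  transition_sum : ∀ i, ∑ j, A i j = 1
  /-- `μ` is nonnegative. -/
  stationary_nonneg : ∀ i, 0 ≤ μ i
  /-- `μ` has total mass one. -/
  stationary_sum : ∑ i, μ i = 1
  /-- Detailed balance; summing over `i` shows that `μ` is stationary for `A`. -/
  reversible : ∀ i j, μ i * A i j = μ j * A j i
  /-- Each `Y k` is a random variable. -/
  measurable : ∀ k, Measurable (Y k)
  /-- The chain starts from `μ`. -/
  initial : ∀ y, P.real {ω | Y 0 ω = y} = μ y
  /-- The Markov property with transition matrix `A`:
  `P[Y_{k+1} = y_{k+1} | Y_0 = y_0, …, Y_k = y_k] = A (y_k) (y_{k+1})`, multiplied by the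
  probability of the condition (so that it is void when that probability is zero). -/
  markov : ∀ (k : ℕ) (y : ℕ → Fin N),
    P.real {ω | ∀ i ≤ k + 1, Y i ω = y i} =
      P.real {ω | ∀ i ≤ k, Y i ω = y i} * A (y k) (y (k + 1))

/-! The proof is Halász' Fourier method, with the characteristic function of the sum controlled by
the spectral gap of the chain. Put `a = 1 - λ`, `m = n / 2`, and reduce modulo a large prime `p`, so
that a point probability is at most the average over `ξ : ZMod p` of the modulus of the
characteristic function.

Spectral side: the expectation of a product of weights `u_k (Y_k)` is the mean of an iterated
product of the operators `A` and multiplication by `u_k`. Writing `A = (1 - λ) E_μ + R` with `‖R‖ ≤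
λ`, the block `A u A` has norm at most `1 - a² (1 - |mean of u|)` (`wnorm_chainOp_mul_chainOp_le`).
For a centred sign the mean of the character is a cosine, so using every second weight gives `exp
(-(a² / 2) ∑ sin²)` over `m` of the coefficients (`norm_integral_stdAddChar_le`).

Arithmetic side: the square root of `∑ sin²` is subadditive in `ξ`, so its sublevel sets `B r`
satisfy `B r + B s ⊆ B (r + s)`, and Cauchy–Davenport makes them grow at least linearly. Parseval,
where distinctness of the coefficients enters, bounds `B (√m / 2)` by `4 p / m`; going back down
about `√m / r` steps leaves `O (p r³ / m^(3/2))` nonzero frequencies in `B r`, for `r ≥ 1`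
(`card_sineBall_sub_one_le`). Summing over layers with `r = √(l + 1) / a` produces the factor `a⁻³
m^(-3/2)`. -/

/-! ### Sublevel sets of the sine energy modulo `p` -/

open Finset Pointwise in
/-- A Cauchy–Davenport bound for dilates in a filtration of subsets of `ZMod p`. -/
theorem min_le_card_of_add_subset {p : ℕ} [Fact p.Prime] (B : ℝ → Finset (ZMod p))
    (hB0 : ∀ r, 0 ≤ r → 0 ∈ B r) (hB : ∀ r s, 0 ≤ r → 0 ≤ s → B r + B s ⊆ B (r + s))
    {r : ℝ} (hr : 0 ≤ r) (k : ℕ) :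
    min p (k * (#(B r) - 1) + 1) ≤ #(B (k * r)) := by
  induction k with
  | zero =>
    have : 0 < #(B ((0 : ℕ) * r)) := card_pos.2 ⟨0, hB0 _ (by simp)⟩
    simp only [zero_mul, zero_add]
    omega
  | succ k ih =>
    have hk : 0 ≤ (k : ℝ) * r := by positivity
    have h1 : (B (k * r)).Nonempty := ⟨0, hB0 _ hk⟩
    have h2 : (B r).Nonempty := ⟨0, hB0 _ hr⟩
    have h3 := ZMod.cauchy_davenport (Fact.out : p.Prime) h1 h2
    have h4 := card_le_card (hB _ _ hk hr)
    have h5 : (k : ℝ) * r + r = ((k + 1 : ℕ) : ℝ) * r := by push_cast; ring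
    rw [h5] at h4
    have h6 : 0 < #(B r) := card_pos.2 h2
    rw [add_mul, one_mul]
    omega

/-- The quadratic form `∑ j, sin² (2 π ξ v_j / p)` attached to residues `v_j` modulo `p`. -/
noncomputable def sineEnergy {p : ℕ} [NeZero p] {ι : Type*} [Fintype ι] (v : ι → ZMod p)
    (ξ : ZMod p) : ℝ :=
  ∑ j, (ZMod.stdAddChar (ξ * v j) : ℂ).im ^ 2

theorem sineEnergy_nonneg {p : ℕ} [NeZero p] {ι : Type*} [Fintype ι] (v : ι → ZMod p)
    (ξ : ZMod p) : 0 ≤ sineEnergy v ξ :=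
  Finset.sum_nonneg fun _ _ => sq_nonneg _

theorem sineEnergy_zero {p : ℕ} [NeZero p] {ι : Type*} [Fintype ι] (v : ι → ZMod p) :
    sineEnergy v 0 = 0 := by
  simp [sineEnergy]

theorem abs_im_mul_le {z w : ℂ} (hz : ‖z‖ = 1) (hw : ‖w‖ = 1) :
    |(z * w).im| ≤ |z.im| + |w.im| := by
  rw [Complex.mul_im]
  have h1 : |z.re| ≤ 1 := hz ▸ Complex.abs_re_le_norm z
  have h2 : |w.re| ≤ 1 := hw ▸ Complex.abs_re_le_norm w
  calc |z.re * w.im + z.im * w.re| ≤ |z.re| * |w.im| + |z.im| * |w.re| := by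
        rw [← abs_mul, ← abs_mul]; exact abs_add_le _ _
    _ ≤ 1 * |w.im| + |z.im| * 1 := by gcongr
    _ = |z.im| + |w.im| := by ring

/-- The square root of the energy is the Euclidean norm of the vector of values `|sin|`, and `|sin
(α + β)| ≤ |sin α| + |sin β|` in each coordinate; Minkowski's inequality does the rest. -/
theorem sqrt_sineEnergy_add_le {p : ℕ} [NeZero p] {ι : Type*} [Fintype ι] (v : ι → ZMod p)
    (ξ η : ZMod p) :
    √(sineEnergy v (ξ + η)) ≤ √(sineEnergy v ξ) + √(sineEnergy v η) := by
  have key : ∀ ζ, √(sineEnergy v ζ) =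
      ‖WithLp.toLp 2 (fun j => |(ZMod.stdAddChar (ζ * v j) : ℂ).im|)‖ := by
    intro ζ
    simp [EuclideanSpace.norm_eq, sineEnergy]
  rw [key ξ, key η]
  refine le_trans ?_ (norm_add_le _ _)
  rw [EuclideanSpace.norm_eq, sineEnergy]
  refine Real.sqrt_le_sqrt (Finset.sum_le_sum fun j _ => ?_)
  rw [← sq_abs]
  refine pow_le_pow_left₀ (abs_nonneg _) ?_ 2
  simp only [PiLp.add_apply, Real.norm_eq_abs]
  rw [add_mul, AddChar.map_add_eq_mul]
  exact (abs_im_mul_le (AddChar.norm_apply _ _) (AddChar.norm_apply _ _)).trans (le_abs_self _)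

/-- Parseval's identity for an exponential sum with distinct frequencies. -/
theorem sum_normSq_sum_stdAddChar {p : ℕ} [NeZero p] {ι : Type*} [Fintype ι]
    {w : ι → ZMod p} (hw : Function.Injective w) :
    ∑ ξ : ZMod p, ‖∑ j, (ZMod.stdAddChar (ξ * w j) : ℂ)‖ ^ 2 = p * Fintype.card ι := by
  classical
  have h : ∀ ξ : ZMod p, ((‖∑ j, (ZMod.stdAddChar (ξ * w j) : ℂ)‖ ^ 2 : ℝ) : ℂ) =
      ∑ j, ∑ k, (ZMod.stdAddChar (ξ * (w j - w k)) : ℂ) := by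
    intro ξ
    push_cast
    rw [← Complex.mul_conj', map_sum, Finset.sum_mul_sum]
    refine Finset.sum_congr rfl fun j _ => Finset.sum_congr rfl fun k _ => ?_
    rw [← AddChar.map_neg_eq_conj, ← AddChar.map_add_eq_mul]
    congr 1; ring
  have h2 : ((∑ ξ : ZMod p, ‖∑ j, (ZMod.stdAddChar (ξ * w j) : ℂ)‖ ^ 2 : ℝ) : ℂ) =
      ((p * Fintype.card ι : ℝ) : ℂ) := by
    rw [Complex.ofReal_sum, Finset.sum_congr rfl fun ξ _ => h ξ, Finset.sum_comm]
    simp_rw [Finset.sum_comm (s := (Finset.univ : Finset (ZMod p))),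
      AddChar.sum_mulShift _ (ZMod.isPrimitive_stdAddChar p), sub_eq_zero, hw.eq_iff]
    simp [ZMod.card, mul_comm]
  exact_mod_cast h2

open Classical in
/-- The sublevel set `{ξ | √(sineEnergy v ξ) ≤ r}`. -/
noncomputable def sineBall {p : ℕ} [NeZero p] {ι : Type*} [Fintype ι] (v : ι → ZMod p)
    (r : ℝ) : Finset (ZMod p) :=
  {ξ | √(sineEnergy v ξ) ≤ r}

theorem mem_sineBall {p : ℕ} [NeZero p] {ι : Type*} [Fintype ι] {v : ι → ZMod p}
    {r : ℝ} {ξ : ZMod p} : ξ ∈ sineBall v r ↔ √(sineEnergy v ξ) ≤ r := by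
  simp [sineBall]

theorem zero_mem_sineBall {p : ℕ} [NeZero p] {ι : Type*} [Fintype ι] (v : ι → ZMod p)
    {r : ℝ} (hr : 0 ≤ r) : 0 ∈ sineBall v r := by
  simpa [mem_sineBall, sineEnergy_zero] using hr

theorem sineBall_mono {p : ℕ} [NeZero p] {ι : Type*} [Fintype ι] (v : ι → ZMod p)
    {r s : ℝ} (h : r ≤ s) : sineBall v r ⊆ sineBall v s := fun _ hξ =>
  mem_sineBall.2 ((mem_sineBall.1 hξ).trans h)

open Pointwise in
theorem sineBall_add_subset {p : ℕ} [NeZero p] {ι : Type*} [Fintype ι] (v : ι → ZMod p)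
    (r s : ℝ) : sineBall v r + sineBall v s ⊆ sineBall v (r + s) := by
  intro x hx
  obtain ⟨a, ha, b, hb, rfl⟩ := Finset.mem_add.1 hx
  exact mem_sineBall.2 ((sqrt_sineEnergy_add_le v a b).trans
    (add_le_add (mem_sineBall.1 ha) (mem_sineBall.1 hb)))

/-- The sublevel set at a quarter of the maximal energy has density at most `4 / m`. -/
theorem card_sineBall_half_mul_le {p : ℕ} [Fact p.Prime] (hp : p ≠ 2) {ι : Type*} [Fintype ι]
    {v : ι → ZMod p} (hv : Function.Injective v) :
    ((sineBall v (√(Fintype.card ι) / 2)).card : ℝ) * Fintype.card ι ≤ 4 * p := by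
  set m : ℝ := (Fintype.card ι : ℝ) with hm
  have hm0 : 0 ≤ m := by positivity
  rcases hm0.eq_or_lt with h0 | h0
  · rw [← h0]; simp
  have h2 : (2 : ZMod p) ≠ 0 := by
    have := ZMod.natCast_eq_zero_iff 2 p
    rw [Nat.cast_ofNat] at this
    rw [Ne, this]
    intro h
    exact hp ((Nat.prime_dvd_prime_iff_eq Fact.out Nat.prime_two).1 h)
  -- Since `2 sin² θ = 1 - cos 2θ`, the energy is read off from the exponential sum with doubled
  -- frequencies, which stay distinct because `p` is odd. On the ball its real part is at least `m /
  -- 2`.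
  have hw : Function.Injective fun j => 2 * v j := fun a b h => hv (mul_left_cancel₀ h2 h)
  have hpars := sum_normSq_sum_stdAddChar hw
  have hlow : ∀ ξ ∈ sineBall v (√m / 2),
      (m / 2) ^ 2 ≤ ‖∑ j, (ZMod.stdAddChar (ξ * (2 * v j)) : ℂ)‖ ^ 2 := by
    intro ξ hξ
    have hG : sineEnergy v ξ ≤ m / 4 := by
      have := mem_sineBall.1 hξ
      rw [Real.sqrt_le_left (by positivity), div_pow, Real.sq_sqrt hm0] at this
      linarith
    have hre : (∑ j, (ZMod.stdAddChar (ξ * (2 * v j)) : ℂ)).re = m - 2 * sineEnergy v ξ := by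
      rw [Complex.re_sum, sineEnergy, Finset.mul_sum, hm, ← Finset.card_univ,
        Finset.card_eq_sum_ones, Nat.cast_sum, ← Finset.sum_sub_distrib]
      refine Finset.sum_congr rfl fun j _ => ?_
      have h1 : ξ * (2 * v j) = ξ * v j + ξ * v j := by ring
      rw [h1, AddChar.map_add_eq_mul, Complex.mul_re]
      have h3 : Complex.normSq (ZMod.stdAddChar (ξ * v j) : ℂ) = 1 := by
        rw [Complex.normSq_eq_norm_sq, AddChar.norm_apply, one_pow]
      rw [Complex.normSq_apply] at h3
      push_cast
      linarith
    refine pow_le_pow_left₀ (by positivity) ?_ 2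
    calc m / 2 ≤ (∑ j, (ZMod.stdAddChar (ξ * (2 * v j)) : ℂ)).re := by rw [hre]; linarith
      _ ≤ _ := Complex.re_le_norm _
  have h3 : ((sineBall v (√m / 2)).card : ℝ) * (m / 2) ^ 2 ≤ p * m := by
    rw [← hpars, ← nsmul_eq_mul]
    refine (Finset.card_nsmul_le_sum _ _ _ hlow).trans ?_
    exact Finset.sum_le_sum_of_subset_of_nonneg (Finset.subset_univ _) fun _ _ _ => by positivity
  have h4 : (((sineBall v (√m / 2)).card : ℝ) * m) * m ≤ (4 * p) * m := by nlinarith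
  exact le_of_mul_le_mul_right h4 h0

/-- Halász' estimate for the number of nonzero elements of the sublevel sets. -/
theorem card_sineBall_sub_one_le {p : ℕ} [Fact p.Prime] (hp : p ≠ 2) {ι : Type*} [Fintype ι]
    [Nonempty ι] {v : ι → ZMod p} (hv : Function.Injective v) {r : ℝ} (hr : 1 ≤ r) :
    ((sineBall v r).card : ℝ) - 1 ≤
      16 * p * r ^ 3 / (Fintype.card ι * √(Fintype.card ι)) := by
  have hcard : ((sineBall v r).card : ℝ) ≤ p := by
    have := Finset.card_le_univ (sineBall v r)
    rw [ZMod.card] at this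
    exact_mod_cast this
  have hmain := card_sineBall_half_mul_le hp hv
  set m : ℝ := (Fintype.card ι : ℝ) with hm
  have hm1 : 0 < m := by rw [hm]; exact_mod_cast Fintype.card_pos
  set s := √m with hs
  have hs0 : 0 < s := Real.sqrt_pos.2 hm1
  have hsm : m = s ^ 2 := (Real.sq_sqrt hm1.le).symm
  have hp0 : (0 : ℝ) < p := by exact_mod_cast (Fact.out : p.Prime).pos
  rw [le_div_iff₀ (by positivity)]
  -- For such large `r` the trivial bound `p` on the cardinality already suffices; this case
  -- dictates the cubic power of `r`.
  by_cases hcase : s ≤ 2 * r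
  · have h1 : m * s ≤ 8 * r ^ 3 := by
      rw [hsm]
      calc s ^ 2 * s = s ^ 3 := by ring
        _ ≤ (2 * r) ^ 3 := pow_le_pow_left₀ hs0.le hcase 3
        _ = _ := by ring
    calc ((sineBall v r).card - 1) * (m * s) ≤ p * (m * s) := by
          gcongr; linarith
      _ ≤ p * (8 * r ^ 3) := by gcongr
      _ ≤ 16 * p * r ^ 3 := by nlinarith [show 0 ≤ p * r ^ 3 by positivity]
  · push Not at hcase
    -- The largest number of steps of length `r` staying within `√m / 2`; as `s > 2 r`, rounding
    -- down loses at most a factor 2.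
    set k := ⌊s / (2 * r)⌋₊ with hk
    have hk1 : 1 ≤ k := Nat.le_floor (by rw [Nat.cast_one, one_le_div (by linarith)]; exact hcase.le)
    have hk1' : (1 : ℝ) ≤ k := by exact_mod_cast hk1
    have hku : (k : ℝ) * r ≤ s / 2 := by
      have : (k : ℝ) ≤ s / (2 * r) := Nat.floor_le (by positivity)
      rw [le_div_iff₀ (by linarith)] at this
      linarith
    have hkl : s ≤ 4 * r * k := by
      have : s / (2 * r) < k + 1 := Nat.lt_floor_add_one _
      rw [div_lt_iff₀ (by linarith)] at this
      nlinarith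
    have h1 := min_le_card_of_add_subset (sineBall v) (fun r => zero_mem_sineBall v)
      (fun r s _ _ => sineBall_add_subset v r s) (r := r) (by linarith) k
    have h2 := Finset.card_le_card (sineBall_mono v hku)
    -- Here `m > 4`, so the Parseval bound is below `p` and the minimum in Cauchy–Davenport is not
    -- `p`.
    have hb : (((sineBall v (s / 2)).card : ℝ)) < p := by
      have : (4 : ℝ) < m := by rw [hsm]; nlinarith
      nlinarith
    have hb' : (sineBall v (s / 2)).card < p := by exact_mod_cast hb
    have h3 : k * ((sineBall v r).card - 1) + 1 ≤ (sineBall v (s / 2)).card := by omega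
    have h4 : 1 ≤ (sineBall v r).card :=
      Finset.card_pos.2 ⟨0, zero_mem_sineBall v (by linarith)⟩
    have h5 : (k : ℝ) * ((sineBall v r).card - 1) + 1 ≤ (sineBall v (s / 2)).card := by
      have : ((k * ((sineBall v r).card - 1) + 1 : ℕ) : ℝ) ≤ (sineBall v (s / 2)).card := by
        exact_mod_cast h3
      push_cast [Nat.cast_sub h4] at this
      exact this
    have h6 : (0 : ℝ) ≤ (sineBall v r).card - 1 := by
      have : (1 : ℝ) ≤ (sineBall v r).card := by exact_mod_cast h4
      linarith
    calc ((sineBall v r).card - 1) * (m * s)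
        ≤ ((sineBall v r).card - 1) * (m * (4 * r * k)) := by gcongr
      _ = 4 * r * ((k * ((sineBall v r).card - 1)) * m) := by ring
      _ ≤ 4 * r * ((sineBall v (s / 2)).card * m) := by gcongr; linarith
      _ ≤ 4 * r * (4 * p) := by gcongr
      _ = 16 * p * r := by ring
      _ ≤ 16 * p * r ^ 3 := by
          gcongr
          exact le_self_pow₀ hr (by norm_num)

/-! ### Halász' sum over the dual group, by layers -/

/-- The constant `∑ l, (l + 1)² e^{-l/2}`. -/
noncomputable def layerConst : ℝ := ∑' l : ℕ, ((l : ℝ) + 1) ^ 2 * Real.exp (-(1 / 2) * l)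

theorem summable_layer :
    Summable fun l : ℕ => ((l : ℝ) + 1) ^ 2 * Real.exp (-(1 / 2) * l) := by
  have h := (summable_nat_add_iff 1).2
    (Real.summable_pow_mul_exp_neg_nat_mul 2 (r := 1 / 2) (by norm_num))
  refine (h.mul_left (Real.exp (1 / 2))).congr fun l => ?_
  push_cast
  rw [mul_left_comm, ← Real.exp_add]
  congr 2; ring

theorem layerConst_nonneg : 0 ≤ layerConst := tsum_nonneg fun _ => by positivity

/-- The single layer `l = ⌊a² * sineEnergy v ξ⌋` already dominates: `ξ` lies in its ball and the
exponential is at most `e^{-l/2}`. -/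
theorem exp_neg_le_sum_layers {p : ℕ} [NeZero p] {ι : Type*} [Fintype ι] (v : ι → ZMod p)
    {a : ℝ} (ha : 0 < a) {M : ℕ} (ξ : ZMod p) (hM : ⌊a ^ 2 * sineEnergy v ξ⌋₊ < M) :
    Real.exp (-(a ^ 2 / 2) * sineEnergy v ξ) ≤ ∑ l ∈ Finset.range M,
      if ξ ∈ sineBall v (√(l + 1) / a) then Real.exp (-(1 / 2) * l) else 0 := by
  have hn : 0 ≤ a ^ 2 * sineEnergy v ξ := mul_nonneg (sq_nonneg _) (sineEnergy_nonneg v ξ)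
  have h1 := Nat.floor_le hn
  have h2 := Nat.lt_floor_add_one (a ^ 2 * sineEnergy v ξ)
  generalize ⌊a ^ 2 * sineEnergy v ξ⌋₊ = l at hM h1 h2
  have hmem : ξ ∈ sineBall v (√(l + 1) / a) := by
    rw [mem_sineBall, le_div_iff₀ ha, mul_comm]
    refine Real.le_sqrt_of_sq_le ?_
    rw [mul_pow, Real.sq_sqrt (sineEnergy_nonneg v ξ)]
    exact h2.le
  calc Real.exp (-(a ^ 2 / 2) * sineEnergy v ξ) ≤ Real.exp (-(1 / 2) * l) :=
        Real.exp_le_exp.2 (by nlinarith)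
    _ = if ξ ∈ sineBall v (√(l + 1) / a) then Real.exp (-(1 / 2) * l) else 0 := by
        rw [if_pos hmem]
    _ ≤ _ := Finset.single_le_sum
        (f := fun l : ℕ => if ξ ∈ sineBall v (√(l + 1) / a) then Real.exp (-(1 / 2) * l) else 0)
        (fun l _ => by positivity) (Finset.mem_range.2 hM)

/-- The zero frequency lies in every ball. Removing it before counting lets the sharper bound on
`card - 1` be used, and its contribution 1 is kept apart. -/
theorem sum_erase_zero_ite_mem_sineBall {p : ℕ} [NeZero p] {ι : Type*} [Fintype ι]
    (v : ι → ZMod p) {r : ℝ} (hr : 0 ≤ r) (c : ℝ) :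
    (∑ ξ ∈ Finset.univ.erase (0 : ZMod p), if ξ ∈ sineBall v r then c else 0) =
      c * ((sineBall v r).card - 1) := by
  have hmem : (0 : ZMod p) ∈ sineBall v r := zero_mem_sineBall v hr
  have : (Finset.univ.erase (0 : ZMod p)).filter (· ∈ sineBall v r) =
      (sineBall v r).erase 0 := by
    ext ξ; simp
  rw [← Finset.sum_filter, Finset.sum_const, nsmul_eq_mul, mul_comm, this,
    Finset.card_erase_of_mem hmem, Nat.cast_sub (Finset.card_pos.2 ⟨0, hmem⟩), Nat.cast_one]

theorem sqrt_pow_three_le_sq {x : ℝ} (hx : 1 ≤ x) : √x ^ 3 ≤ x ^ 2 := by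
  have h1 : √x ≤ x := Real.sqrt_le_self_iff.2 (Or.inr hx)
  have h2 := Real.sq_sqrt (zero_le_one.trans hx)
  calc √x ^ 3 = √x ^ 2 * √x := by ring
    _ ≤ x * x := by rw [h2]; gcongr
    _ = _ := by ring

/-- Halász' bound for the Gaussian-type sum over the dual group. -/
theorem sum_exp_neg_sineEnergy_le {p : ℕ} [Fact p.Prime] (hp : p ≠ 2) {ι : Type*} [Fintype ι]
    [Nonempty ι] {v : ι → ZMod p} (hv : Function.Injective v) {a : ℝ} (ha : 0 < a)
    (ha1 : a ≤ 1) :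
    ∑ ξ : ZMod p, Real.exp (-(a ^ 2 / 2) * sineEnergy v ξ) ≤
      1 + 16 * layerConst * p / (a ^ 3 * (Fintype.card ι * √(Fintype.card ι))) := by
  obtain ⟨M, hM⟩ : ∃ M : ℕ, ∀ ξ : ZMod p, ⌊a ^ 2 * sineEnergy v ξ⌋₊ < M := by
    obtain ⟨B, hB⟩ := (Set.finite_range fun ξ : ZMod p => ⌊a ^ 2 * sineEnergy v ξ⌋₊).bddAbove
    exact ⟨B + 1, fun ξ => Nat.lt_succ_of_le (hB ⟨ξ, rfl⟩)⟩
  have hD0 : (0 : ℝ) < Fintype.card ι * √(Fintype.card ι) := by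
    have : (0 : ℝ) < Fintype.card ι := by exact_mod_cast Fintype.card_pos
    positivity
  have hcard := fun (l : ℕ) (h : 1 ≤ √((l : ℝ) + 1) / a) => card_sineBall_sub_one_le hp hv h
  generalize (Fintype.card ι * √(Fintype.card ι) : ℝ) = D at hD0 hcard ⊢
  have hr : ∀ l : ℕ, 1 ≤ √((l : ℝ) + 1) / a := fun l => by
    rw [one_le_div ha]
    exact ha1.trans (Real.one_le_sqrt.2 (by simp))
  have hterm : ∀ l : ℕ, Real.exp (-(1 / 2) * l) * ((sineBall v (√(l + 1) / a)).card - 1) ≤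
      16 * p / (a ^ 3 * D) * (((l : ℝ) + 1) ^ 2 * Real.exp (-(1 / 2) * l)) := by
    intro l
    calc Real.exp (-(1 / 2) * l) * ((sineBall v (√(l + 1) / a)).card - 1)
        ≤ Real.exp (-(1 / 2) * l) * (16 * p * (√(l + 1) / a) ^ 3 / D) :=
          mul_le_mul_of_nonneg_left (hcard l (hr l)) (Real.exp_pos _).le
      _ = 16 * p / (a ^ 3 * D) * (√((l : ℝ) + 1) ^ 3 * Real.exp (-(1 / 2) * l)) := by
          rw [div_pow]; field_simp
      _ ≤ _ := by
          have := sqrt_pow_three_le_sq (x := (l : ℝ) + 1) (by simp)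
          gcongr
  have hsum : ∑ ξ ∈ Finset.univ.erase (0 : ZMod p),
      Real.exp (-(a ^ 2 / 2) * sineEnergy v ξ) ≤ 16 * p / (a ^ 3 * D) * layerConst := by
    refine (Finset.sum_le_sum fun ξ _ => exp_neg_le_sum_layers v ha ξ (hM ξ)).trans ?_
    rw [Finset.sum_comm, Finset.sum_congr rfl fun l _ =>
      sum_erase_zero_ite_mem_sineBall v (zero_le_one.trans (hr l)) _]
    refine (Finset.sum_le_sum fun l _ => hterm l).trans ?_
    rw [← Finset.mul_sum]
    exact mul_le_mul_of_nonneg_left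
      (summable_layer.sum_le_tsum _ fun _ _ => by positivity) (by positivity)
  rw [← Finset.add_sum_erase _ _ (Finset.mem_univ (0 : ZMod p)), sineEnergy_zero, mul_zero,
    Real.exp_zero]
  refine add_le_add le_rfl (hsum.trans_eq ?_)
  ring

/-! ### Complex vectors in `L₂(μ)` -/

/-- The mean `∑ i, μ i * w i` of a complex vector. -/
noncomputable def wmean {N : ℕ} (μ : Fin N → ℝ) (w : Fin N → ℂ) : ℂ :=
  ∑ i, (μ i : ℂ) * w i

/-- The norm of a complex vector in `L₂(μ)`. -/
noncomputable def wnorm {N : ℕ} (μ : Fin N → ℝ) (w : Fin N → ℂ) : ℝ :=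
  √(∑ i, μ i * ‖w i‖ ^ 2)

section wnorm

variable {N : ℕ} {μ : Fin N → ℝ}

theorem wnorm_nonneg (w : Fin N → ℂ) : 0 ≤ wnorm μ w := Real.sqrt_nonneg _

theorem wnorm_sq (hμ : ∀ i, 0 ≤ μ i) (w : Fin N → ℂ) :
    wnorm μ w ^ 2 = ∑ i, μ i * ‖w i‖ ^ 2 :=
  Real.sq_sqrt (Finset.sum_nonneg fun i _ => mul_nonneg (hμ i) (sq_nonneg _))

theorem wnorm_eq_norm (hμ : ∀ i, 0 ≤ μ i) (w : Fin N → ℂ) :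
    wnorm μ w = ‖WithLp.toLp 2 (fun i => (√(μ i) : ℂ) * w i)‖ := by
  rw [EuclideanSpace.norm_eq, wnorm]
  congr 1
  refine Finset.sum_congr rfl fun i _ => ?_
  simp only [norm_mul, mul_pow, Complex.norm_real, Real.norm_eq_abs, sq_abs,
    Real.sq_sqrt (hμ i)]

theorem wnorm_add_le (hμ : ∀ i, 0 ≤ μ i) (w z : Fin N → ℂ) :
    wnorm μ (w + z) ≤ wnorm μ w + wnorm μ z := by
  rw [wnorm_eq_norm hμ, wnorm_eq_norm hμ, wnorm_eq_norm hμ]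
  refine le_of_eq_of_le ?_ (norm_add_le _ _)
  congr 1
  ext i
  simp [mul_add]

theorem wnorm_smul (c : ℂ) (w : Fin N → ℂ) : wnorm μ (c • w) = ‖c‖ * wnorm μ w := by
  rw [wnorm, wnorm, ← Real.sqrt_sq (norm_nonneg c), ← Real.sqrt_mul (sq_nonneg _),
    Finset.mul_sum]
  congr 1
  refine Finset.sum_congr rfl fun i _ => ?_
  simp only [Pi.smul_apply, smul_eq_mul, norm_mul]
  ring

theorem wnorm_mul_le (hμ : ∀ i, 0 ≤ μ i) {u : Fin N → ℂ} (hu : ∀ i, ‖u i‖ ≤ 1)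
    (w : Fin N → ℂ) : wnorm μ (u * w) ≤ wnorm μ w := by
  refine Real.sqrt_le_sqrt (Finset.sum_le_sum fun i _ => ?_)
  refine mul_le_mul_of_nonneg_left (pow_le_pow_left₀ (norm_nonneg _) ?_ 2) (hμ i)
  rw [Pi.mul_apply, norm_mul]
  exact mul_le_of_le_one_left (norm_nonneg _) (hu i)

theorem wnorm_const (hμ1 : ∑ i, μ i = 1) (c : ℂ) : wnorm μ (fun _ => c) = ‖c‖ := by
  rw [wnorm, ← Finset.sum_mul, hμ1, one_mul, Real.sqrt_sq (norm_nonneg c)]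

theorem sum_mul_norm_add_const_sq (hμ1 : ∑ i, μ i = 1) (w : Fin N → ℂ) (c : ℂ) :
    ∑ i, μ i * ‖w i + c‖ ^ 2 =
      ∑ i, μ i * ‖w i‖ ^ 2 + 2 * (wmean μ w * (starRingEnd ℂ) c).re + ‖c‖ ^ 2 := by
  have h : ∀ i, μ i * ‖w i + c‖ ^ 2 =
      μ i * ‖w i‖ ^ 2 + 2 * ((μ i : ℂ) * w i * (starRingEnd ℂ) c).re + μ i * ‖c‖ ^ 2 := by
    intro i
    rw [Complex.sq_norm, Complex.normSq_add, Complex.sq_norm, Complex.sq_norm, mul_assoc,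
      Complex.re_ofReal_mul]
    ring
  rw [Finset.sum_congr rfl fun i _ => h i, Finset.sum_add_distrib, Finset.sum_add_distrib,
    ← Finset.sum_mul, hμ1, one_mul, ← Finset.mul_sum, ← Complex.re_sum, ← Finset.sum_mul, wmean]

/-- The variance decomposition. -/
theorem sum_mul_norm_sub_wmean_sq (hμ1 : ∑ i, μ i = 1) (w : Fin N → ℂ) :
    ∑ i, μ i * ‖w i - wmean μ w‖ ^ 2 = ∑ i, μ i * ‖w i‖ ^ 2 - ‖wmean μ w‖ ^ 2 := by
  have h := sum_mul_norm_add_const_sq hμ1 w (-wmean μ w)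
  simp only [← sub_eq_add_neg, map_neg, norm_neg, mul_neg, Complex.mul_conj', Complex.neg_re] at h
  rw [h]
  have : (((‖wmean μ w‖ : ℂ)) ^ 2).re = ‖wmean μ w‖ ^ 2 := by
    rw [← Complex.ofReal_pow, Complex.ofReal_re]
  rw [this]
  ring

theorem norm_wmean_le (hμ : ∀ i, 0 ≤ μ i) (hμ1 : ∑ i, μ i = 1) (w : Fin N → ℂ) :
    ‖wmean μ w‖ ≤ wnorm μ w := by
  refine Real.le_sqrt_of_sq_le ?_
  have h := sum_mul_norm_sub_wmean_sq hμ1 w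
  have : 0 ≤ ∑ i, μ i * ‖w i - wmean μ w‖ ^ 2 :=
    Finset.sum_nonneg fun i _ => mul_nonneg (hμ i) (sq_nonneg _)
  linarith

end wnorm

/-! ### Contraction from the spectral gap -/

/-- A stochastic matrix acting on complex vectors. -/
noncomputable def chainOp {N : ℕ} (A : Matrix (Fin N) (Fin N) ℝ) (w : Fin N → ℂ) : Fin N → ℂ :=
  (A.map Complex.ofReal).mulVec w

theorem chainOp_apply {N : ℕ} (A : Matrix (Fin N) (Fin N) ℝ) (w : Fin N → ℂ) (i : Fin N) :
    chainOp A w i = ∑ j, (A i j : ℂ) * w j := rfl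

/-- The hypotheses on a reversible stochastic matrix. -/
structure IsReversibleStochastic {N : ℕ} (A : Matrix (Fin N) (Fin N) ℝ) (μ : Fin N → ℝ) :
    Prop where
  transition_nonneg : ∀ i j, 0 ≤ A i j
  transition_sum : ∀ i, ∑ j, A i j = 1
  stationary_nonneg : ∀ i, 0 ≤ μ i
  stationary_sum : ∑ i, μ i = 1
  reversible : ∀ i j, μ i * A i j = μ j * A j i

namespace IsReversibleStochastic

variable {N : ℕ} {A : Matrix (Fin N) (Fin N) ℝ} {μ : Fin N → ℝ}

theorem stationary (h : IsReversibleStochastic A μ) (j : Fin N) : ∑ i, μ i * A i j = μ j := by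
  rw [Finset.sum_congr rfl fun i _ => h.reversible i j, ← Finset.mul_sum, h.transition_sum,
    mul_one]

theorem sum_mul_sq_mulVec_le (h : IsReversibleStochastic A μ) (v : Fin N → ℝ) :
    ∑ i, μ i * (A.mulVec v i) ^ 2 ≤ ∑ i, μ i * v i ^ 2 := by
  have h1 : ∀ i, (A.mulVec v i) ^ 2 ≤ ∑ j, A i j * v j ^ 2 := by
    intro i
    have h2 : 0 ≤ ∑ j, A i j * (v j - A.mulVec v i) ^ 2 :=
      Finset.sum_nonneg fun j _ => mul_nonneg (h.transition_nonneg i j) (sq_nonneg _)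
    have h3 : ∑ j, A i j * (v j - A.mulVec v i) ^ 2 =
        ∑ j, A i j * v j ^ 2 - (A.mulVec v i) ^ 2 := by
      have h4 : ∀ j, A i j * (v j - A.mulVec v i) ^ 2 = A i j * v j ^ 2 -
          2 * A.mulVec v i * (A i j * v j) + (A.mulVec v i) ^ 2 * A i j := fun j => by ring
      rw [Finset.sum_congr rfl fun j _ => h4 j, Finset.sum_add_distrib, Finset.sum_sub_distrib,
        ← Finset.mul_sum, ← Finset.mul_sum, h.transition_sum]
      have h5 : ∑ j, A i j * v j = A.mulVec v i := rfl
      rw [h5]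
      ring
    linarith
  calc ∑ i, μ i * (A.mulVec v i) ^ 2 ≤ ∑ i, μ i * ∑ j, A i j * v j ^ 2 :=
        Finset.sum_le_sum fun i _ => mul_le_mul_of_nonneg_left (h1 i) (h.stationary_nonneg i)
    _ = ∑ j, (∑ i, μ i * A i j) * v j ^ 2 := by
        simp_rw [Finset.mul_sum, Finset.sum_mul]
        rw [Finset.sum_comm]
        refine Finset.sum_congr rfl fun j _ => Finset.sum_congr rfl fun i _ => by ring
    _ = _ := by simp_rw [h.stationary]

theorem sub_averagingOp_mulVec (v : Fin N → ℝ) (i : Fin N) :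
    (A - averagingOp μ).mulVec v i = A.mulVec v i - ∑ j, μ j * v j := by
  rw [Matrix.sub_mulVec]; rfl

/-- `A - E_μ` is `A` applied after centring; `A` contracts by Jensen and centring does not increase
the second moment. This bounds the set whose supremum is `chainLambda`, so that the supremum is
meaningful. -/
theorem L2norm_sub_averagingOp_mulVec_le (h : IsReversibleStochastic A μ) (v : Fin N → ℝ) :
    L2norm μ ((A - averagingOp μ).mulVec v) ≤ L2norm μ v := by
  set m := ∑ j, μ j * v j with hm
  have h1 : ∀ i, (A - averagingOp μ).mulVec v i = A.mulVec (fun j => v j - m) i := by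
    intro i
    rw [sub_averagingOp_mulVec]
    simp only [Matrix.mulVec, dotProduct, mul_sub, Finset.sum_sub_distrib, ← Finset.sum_mul,
      h.transition_sum, one_mul, hm]
  refine Real.sqrt_le_sqrt ?_
  simp only [sq_abs]
  calc ∑ i, ((A - averagingOp μ).mulVec v i) ^ 2 * μ i
      = ∑ i, μ i * (A.mulVec (fun j => v j - m) i) ^ 2 :=
        Finset.sum_congr rfl fun i _ => by rw [h1, mul_comm]
    _ ≤ ∑ i, μ i * (v i - m) ^ 2 := h.sum_mul_sq_mulVec_le _
    _ = ∑ i, (v i ^ 2 * μ i - 2 * m * (μ i * v i) + m ^ 2 * μ i) :=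
        Finset.sum_congr rfl fun i _ => by ring
    _ = ∑ i, v i ^ 2 * μ i - m ^ 2 := by
        rw [Finset.sum_add_distrib, Finset.sum_sub_distrib, ← Finset.mul_sum, ← Finset.mul_sum,
          h.stationary_sum, ← hm]
        ring
    _ ≤ _ := sub_le_self _ (sq_nonneg m)

theorem chainLambda_nonneg (A : Matrix (Fin N) (Fin N) ℝ) (μ : Fin N → ℝ) :
    0 ≤ chainLambda A μ := by
  refine Real.sSup_nonneg ?_
  rintro r ⟨v, -, rfl⟩
  exact Real.sqrt_nonneg _

theorem L2norm_smul (c : ℝ) (v : Fin N → ℝ) : L2norm μ (c • v) = |c| * L2norm μ v := by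
  rw [L2norm, L2norm, ← Real.sqrt_sq (abs_nonneg c), ← Real.sqrt_mul (sq_nonneg _),
    Finset.mul_sum]
  congr 1
  refine Finset.sum_congr rfl fun i _ => ?_
  simp only [Pi.smul_apply, smul_eq_mul, abs_mul]
  ring

theorem L2norm_sub_averagingOp_mulVec_le_chainLambda (h : IsReversibleStochastic A μ)
    (v : Fin N → ℝ) :
    L2norm μ ((A - averagingOp μ).mulVec v) ≤ chainLambda A μ * L2norm μ v := by
  have hb : BddAbove {r : ℝ | ∃ v : Fin N → ℝ, L2norm μ v = 1 ∧
      r = L2norm μ ((A - averagingOp μ).mulVec v)} := by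
    refine ⟨1, ?_⟩
    rintro r ⟨v, hv, rfl⟩
    exact (h.L2norm_sub_averagingOp_mulVec_le v).trans_eq hv
  have h0 : 0 ≤ L2norm μ v := Real.sqrt_nonneg _
  rcases h0.eq_or_lt with h0 | h0
  · rw [← h0, mul_zero, h0]
    exact h.L2norm_sub_averagingOp_mulVec_le v
  · have h1 : L2norm μ ((L2norm μ v)⁻¹ • v) = 1 := by
      rw [L2norm_smul, abs_of_pos (inv_pos.2 h0), inv_mul_cancel₀ h0.ne']
    have h2 : L2norm μ ((A - averagingOp μ).mulVec ((L2norm μ v)⁻¹ • v)) ≤ chainLambda A μ :=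
      le_csSup hb ⟨_, h1, rfl⟩
    rwa [Matrix.mulVec_smul, L2norm_smul, abs_of_pos (inv_pos.2 h0), inv_mul_le_iff₀ h0,
      mul_comm] at h2

theorem sum_mul_sq_sub_averagingOp_le (h : IsReversibleStochastic A μ) (v : Fin N → ℝ) :
    ∑ i, μ i * (A.mulVec v i - ∑ j, μ j * v j) ^ 2 ≤
      chainLambda A μ ^ 2 * ∑ i, μ i * v i ^ 2 := by
  have hsq : ∀ w : Fin N → ℝ, L2norm μ w ^ 2 = ∑ i, μ i * w i ^ 2 := by
    intro w
    rw [L2norm, Real.sq_sqrt (Finset.sum_nonneg fun i _ =>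
      mul_nonneg (sq_nonneg _) (h.stationary_nonneg i))]
    exact Finset.sum_congr rfl fun i _ => by rw [sq_abs, mul_comm]
  have h1 := pow_le_pow_left₀ (Real.sqrt_nonneg _)
    (h.L2norm_sub_averagingOp_mulVec_le_chainLambda v) 2
  change L2norm μ _ ^ 2 ≤ _ at h1
  rw [mul_pow, hsq, hsq] at h1
  simpa only [sub_averagingOp_mulVec] using h1

theorem chainOp_re (w : Fin N → ℂ) (i : Fin N) :
    (chainOp A w i).re = A.mulVec (fun j => (w j).re) i := by
  rw [chainOp_apply, Complex.re_sum]
  exact Finset.sum_congr rfl fun j _ => Complex.re_ofReal_mul _ _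

theorem chainOp_im (w : Fin N → ℂ) (i : Fin N) :
    (chainOp A w i).im = A.mulVec (fun j => (w j).im) i := by
  rw [chainOp_apply, Complex.im_sum]
  exact Finset.sum_congr rfl fun j _ => Complex.im_ofReal_mul _ _

theorem wmean_re (w : Fin N → ℂ) : (wmean μ w).re = ∑ j, μ j * (w j).re := by
  rw [wmean, Complex.re_sum]
  exact Finset.sum_congr rfl fun j _ => Complex.re_ofReal_mul _ _

theorem wmean_im (w : Fin N → ℂ) : (wmean μ w).im = ∑ j, μ j * (w j).im := by
  rw [wmean, Complex.im_sum]
  exact Finset.sum_congr rfl fun j _ => Complex.im_ofReal_mul _ _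

theorem sum_mul_norm_sq (w : Fin N → ℂ) : ∑ i, μ i * ‖w i‖ ^ 2 =
    ∑ i, μ i * (w i).re ^ 2 + ∑ i, μ i * (w i).im ^ 2 := by
  rw [← Finset.sum_add_distrib]
  refine Finset.sum_congr rfl fun i _ => ?_
  rw [Complex.sq_norm, Complex.normSq_apply]
  ring

theorem wnorm_chainOp_le (h : IsReversibleStochastic A μ) (w : Fin N → ℂ) :
    wnorm μ (chainOp A w) ≤ wnorm μ w := by
  refine Real.sqrt_le_sqrt ?_
  rw [sum_mul_norm_sq, sum_mul_norm_sq]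
  simp only [chainOp_re, chainOp_im]
  exact add_le_add (h.sum_mul_sq_mulVec_le _) (h.sum_mul_sq_mulVec_le _)

/-- `A` and `E_μ` are real, so the bound passes from real to complex vectors through real and
imaginary parts. -/
theorem sum_mul_norm_chainOp_sub_wmean_sq_le (h : IsReversibleStochastic A μ) (w : Fin N → ℂ) :
    ∑ i, μ i * ‖chainOp A w i - wmean μ w‖ ^ 2 ≤
      chainLambda A μ ^ 2 * ∑ i, μ i * ‖w i‖ ^ 2 := by
  rw [sum_mul_norm_sq, sum_mul_norm_sq]
  simp only [Complex.sub_re, Complex.sub_im, chainOp_re, chainOp_im, wmean_re, wmean_im, mul_add]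
  exact add_le_add (h.sum_mul_sq_sub_averagingOp_le _) (h.sum_mul_sq_sub_averagingOp_le _)

theorem chainOp_const (h : IsReversibleStochastic A μ) (c : ℂ) :
    chainOp A (Function.const _ c) = Function.const _ c := by
  ext i
  simp only [chainOp_apply, Function.const_apply]
  rw [← Finset.sum_mul, ← Complex.ofReal_sum, h.transition_sum,
    Complex.ofReal_one, one_mul]

theorem wmean_const (h : IsReversibleStochastic A μ) (c : ℂ) :
    wmean μ (Function.const _ c) = c := by
  simp only [wmean, Function.const_apply]
  rw [← Finset.sum_mul, ← Complex.ofReal_sum, h.stationary_sum, Complex.ofReal_one,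
    one_mul]

theorem wmean_chainOp (h : IsReversibleStochastic A μ) (w : Fin N → ℂ) :
    wmean μ (chainOp A w) = wmean μ w := by
  simp only [wmean, chainOp_apply, Finset.mul_sum]
  rw [Finset.sum_comm]
  refine Finset.sum_congr rfl fun j _ => ?_
  simp_rw [← mul_assoc]
  rw [← Finset.sum_mul]
  congr 1
  exact_mod_cast h.stationary j

theorem wmean_sub (w z : Fin N → ℂ) : wmean μ (w - z) = wmean μ w - wmean μ z := by
  simp [wmean, mul_sub]

theorem chainOp_sub (w z : Fin N → ℂ) : chainOp A (w - z) = chainOp A w - chainOp A z :=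
  Matrix.mulVec_sub _ _ _

theorem chainOp_add (w z : Fin N → ℂ) : chainOp A (w + z) = chainOp A w + chainOp A z :=
  Matrix.mulVec_add _ _ _

theorem chainOp_smul (c : ℂ) (w : Fin N → ℂ) : chainOp A (c • w) = c • chainOp A w :=
  Matrix.mulVec_smul _ _ _

/-- The remainder `A - (1 - λ) E_μ` has norm at most `λ`. -/
theorem wnorm_remainder_le (h : IsReversibleStochastic A μ) (w : Fin N → ℂ) :
    wnorm μ (fun i => chainOp A w i - (1 - chainLambda A μ : ℝ) * wmean μ w) ≤
      chainLambda A μ * wnorm μ w := by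
  set l := chainLambda A μ with hl
  have hl0 : 0 ≤ l := chainLambda_nonneg A μ
  set m := wmean μ w with hm
  -- The remainder is a mean-zero part plus the constant `l * m`. These are orthogonal, with squared
  -- norms at most `l² (‖w‖² - |m|²)` and equal to `l² |m|²`, which add up to `l² ‖w‖²`.
  have h1 : ∀ i, chainOp A w i - (1 - l : ℝ) * m = (chainOp A w - Function.const (Fin N) m : Fin N → ℂ) i + l * m := by
    intro i
    simp only [Pi.sub_apply, Function.const_apply]
    push_cast
    ring
  have h2 : wmean μ (chainOp A w - Function.const _ m) = 0 := by
    rw [wmean_sub, h.wmean_chainOp, h.wmean_const, sub_self]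
  have h3 : chainOp A w - Function.const _ m = fun i =>
      chainOp A (w - Function.const _ m) i - wmean μ (w - Function.const _ m) := by
    ext i
    rw [chainOp_sub, wmean_sub, h.wmean_const, h.chainOp_const, ← hm, sub_self, sub_zero]
  have h4 : ∑ i, μ i * ‖(chainOp A w - Function.const (Fin N) m : Fin N → ℂ) i‖ ^ 2 ≤
      l ^ 2 * (∑ i, μ i * ‖w i‖ ^ 2 - ‖m‖ ^ 2) := by
    rw [h3, hm, ← sum_mul_norm_sub_wmean_sq h.stationary_sum w]
    exact h.sum_mul_norm_chainOp_sub_wmean_sq_le _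
  rw [wnorm, Real.sqrt_le_left (mul_nonneg hl0 (wnorm_nonneg _)), mul_pow,
    wnorm_sq h.stationary_nonneg]
  simp only [h1]
  rw [sum_mul_norm_add_const_sq h.stationary_sum, h2, zero_mul, Complex.zero_re, norm_mul,
    Complex.norm_real, Real.norm_eq_abs, mul_pow, sq_abs]
  linarith

/-- Multiplying by a function of modulus at most one between two steps of the chain contracts
`L₂(μ)`, by an amount governed by the mean of that function. -/
theorem wnorm_chainOp_mul_chainOp_le (h : IsReversibleStochastic A μ)
    (hlt : chainLambda A μ ≤ 1) {u : Fin N → ℂ} (hu : ∀ i, ‖u i‖ ≤ 1) (w : Fin N → ℂ) :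
    wnorm μ (chainOp A (u * chainOp A w)) ≤
      (1 - (1 - chainLambda A μ) ^ 2 * (1 - ‖wmean μ u‖)) * wnorm μ w := by
  have hR := h.wnorm_remainder_le
  set l := chainLambda A μ with hl
  have hl0 : 0 ≤ l := chainLambda_nonneg A μ
  have hl1 : 0 ≤ 1 - l := sub_nonneg.2 hlt
  set R : (Fin N → ℂ) → Fin N → ℂ := fun w i => chainOp A w i - (1 - l : ℝ) * wmean μ w
  have hA : ∀ w, chainOp A w = (fun _ => (1 - l : ℝ) * wmean μ w) + R w := by
    intro w; ext i; simp [R]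
  have hu1 : wnorm μ u ≤ 1 := by
    have := wnorm_mul_le h.stationary_nonneg hu (fun _ => 1)
    rw [wnorm_const h.stationary_sum, norm_one] at this
    convert this using 2
    ext i; simp
  have hm := norm_wmean_le h.stationary_nonneg h.stationary_sum w
  -- The inner `A` is split first; the outer one is split only on the `E_μ` part. The three norms
  -- have coefficients `(1 - l)² |mean u|`, `(1 - l) l` and `l`, and the last two sum to `1 - (1 -
  -- l)²`.
  have key : chainOp A (u * chainOp A w) =
      ((1 - l : ℝ) * wmean μ w) • (fun _ => (1 - l : ℝ) * wmean μ u) +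
      (((1 - l : ℝ) * wmean μ w) • R u + chainOp A (u * R w)) := by
    have h1 : u * chainOp A w = ((1 - l : ℝ) * wmean μ w) • u + u * R w := by
      rw [hA w]; ext i; simp; ring
    rw [h1, chainOp_add, chainOp_smul, hA u, smul_add, add_assoc]
  rw [key]
  refine (wnorm_add_le h.stationary_nonneg _ _).trans ?_
  refine (add_le_add le_rfl (wnorm_add_le h.stationary_nonneg _ _)).trans ?_
  have e1 : wnorm μ (((1 - l : ℝ) * wmean μ w) • (fun _ => (1 - l : ℝ) * wmean μ u)) ≤
      (1 - l) ^ 2 * ‖wmean μ u‖ * wnorm μ w := by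
    rw [wnorm_smul, wnorm_const h.stationary_sum, norm_mul, norm_mul, Complex.norm_real,
      Real.norm_of_nonneg hl1]
    calc (1 - l) * ‖wmean μ w‖ * ((1 - l) * ‖wmean μ u‖)
        = (1 - l) ^ 2 * ‖wmean μ u‖ * ‖wmean μ w‖ := by ring
      _ ≤ _ := by gcongr
  have e2 : wnorm μ (((1 - l : ℝ) * wmean μ w) • R u) ≤ (1 - l) * l * wnorm μ w := by
    rw [wnorm_smul, norm_mul, Complex.norm_real, Real.norm_of_nonneg hl1]
    have : wnorm μ (R u) ≤ l := (hR u).trans (mul_le_of_le_one_right hl0 hu1)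
    calc (1 - l) * ‖wmean μ w‖ * wnorm μ (R u) ≤ (1 - l) * wnorm μ w * l := by
          gcongr
          · exact wnorm_nonneg (R u)
          · exact mul_nonneg hl1 (wnorm_nonneg w)
      _ = _ := by ring
  have e3 : wnorm μ (chainOp A (u * R w)) ≤ l * wnorm μ w :=
    (h.wnorm_chainOp_le _).trans ((wnorm_mul_le h.stationary_nonneg hu _).trans (hR w))
  refine (add_le_add e1 (add_le_add e2 e3)).trans_eq ?_
  ring

end IsReversibleStochastic

/-! ### Products of weights along the chain -/

/-- The functions `ψ₀ = 1`, `ψ_{k+1} = A (u_k ψ_k)`. -/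
noncomputable def chainState {N : ℕ} (A : Matrix (Fin N) (Fin N) ℝ) (u : ℕ → Fin N → ℂ) :
    ℕ → Fin N → ℂ
  | 0 => fun _ => 1
  | k + 1 => chainOp A (u k * chainState A u k)

/-- Steps are grouped in pairs: an odd-indexed weight sits between two copies of `A` and gives a
gain, while even-indexed weights, and a final unpaired step, are only contractions. -/
theorem IsReversibleStochastic.norm_wmean_chainState_le {N : ℕ} {A : Matrix (Fin N) (Fin N) ℝ}
    {μ : Fin N → ℝ} (h : IsReversibleStochastic A μ) (hlt : chainLambda A μ ≤ 1)
    {u : ℕ → Fin N → ℂ} (hu : ∀ k i, ‖u k i‖ ≤ 1) (n : ℕ) :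
    ‖wmean μ (chainState A u n)‖ ≤ ∏ i ∈ Finset.range (n / 2),
      (1 - (1 - chainLambda A μ) ^ 2 * (1 - ‖wmean μ (u (2 * i + 1))‖)) := by
  have hl0 : 0 ≤ chainLambda A μ := IsReversibleStochastic.chainLambda_nonneg A μ
  have hq : (1 - chainLambda A μ) ^ 2 ≤ 1 := pow_le_one₀ (sub_nonneg.2 hlt) (by linarith)
  have hfac : ∀ i, 0 ≤ 1 - (1 - chainLambda A μ) ^ 2 * (1 - ‖wmean μ (u (2 * i + 1))‖) := by
    intro i
    have : 0 ≤ ‖wmean μ (u (2 * i + 1))‖ := norm_nonneg _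
    nlinarith [sq_nonneg (1 - chainLambda A μ)]
  have heven : ∀ k, wnorm μ (chainState A u (2 * k)) ≤ ∏ i ∈ Finset.range k,
      (1 - (1 - chainLambda A μ) ^ 2 * (1 - ‖wmean μ (u (2 * i + 1))‖)) := by
    intro k
    induction k with
    | zero => simp [chainState, wnorm_const h.stationary_sum]
    | succ k ih =>
      rw [Finset.prod_range_succ, mul_comm (∏ i ∈ Finset.range k, _)]
      have h1 := h.wnorm_chainOp_mul_chainOp_le hlt (hu (2 * k + 1))
        (u (2 * k) * chainState A u (2 * k))
      refine h1.trans (mul_le_mul_of_nonneg_left ?_ (hfac k))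
      exact (wnorm_mul_le h.stationary_nonneg (hu _) _).trans ih
  refine (norm_wmean_le h.stationary_nonneg h.stationary_sum _).trans ?_
  refine le_trans ?_ (heven (n / 2))
  rcases Nat.mod_two_eq_zero_or_one n with h2 | h2
  · rw [show 2 * (n / 2) = n by omega]
  · conv_lhs => rw [show n = 2 * (n / 2) + 1 by omega]
    exact (h.wnorm_chainOp_le _).trans (wnorm_mul_le h.stationary_nonneg (hu _) _)

open MeasureTheory

section Chain

variable {N : ℕ} {Ω : Type*} [MeasurableSpace Ω] {P : Measure Ω}
  {A : Matrix (Fin N) (Fin N) ℝ} {μ : Fin N → ℝ} {Y : ℕ → Ω → Fin N}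

theorem IsStationaryReversibleMarkovChain.isReversibleStochastic
    (h : IsStationaryReversibleMarkovChain P A μ Y) : IsReversibleStochastic A μ :=
  ⟨h.transition_nonneg, h.transition_sum, h.stationary_nonneg, h.stationary_sum, h.reversible⟩

theorem integral_comp_eq_sum [IsFiniteMeasure P] {α : Type*} [Fintype α] [MeasurableSpace α]
    [MeasurableSingletonClass α] {Z : Ω → α} (hZ : Measurable Z) (F : α → ℂ) :
    ∫ ω, F (Z ω) ∂P = ∑ z, (P.real {ω | Z ω = z} : ℂ) * F z := by
  rw [← integral_map (f := F) hZ.aemeasurable (measurable_of_finite F).aestronglyMeasurable,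
    integral_fintype Integrable.of_finite]
  refine Finset.sum_congr rfl fun z _ => ?_
  rw [map_measureReal_apply hZ (measurableSet_singleton z), Complex.real_smul]
  rfl

/-- One step of the Markov property, tested against a function of the past. -/
theorem IsStationaryReversibleMarkovChain.integral_mul_ite [IsProbabilityMeasure P]
    (h : IsStationaryReversibleMarkovChain P A μ Y) (k : ℕ) (g : (Fin (k + 1) → Fin N) → ℂ)
    (y : Fin N) :
    ∫ ω, g (fun i => Y i ω) * (if Y (k + 1) ω = y then 1 else 0) ∂P =
      ∫ ω, g (fun i => Y i ω) * A (Y k ω) y ∂P := by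
  have hZ : Measurable fun ω => fun i : Fin (k + 1) => Y i ω :=
    measurable_pi_lambda _ fun i => h.measurable i
  have hZ' := hZ.prodMk (h.measurable (k + 1))
  have e1 := integral_comp_eq_sum (P := P) hZ'
    (fun z => g z.1 * (if z.2 = y then 1 else 0))
  have e2 := integral_comp_eq_sum (P := P) hZ (fun z => g z * A (z (Fin.last k)) y)
  simp only [Fin.val_last] at e1 e2
  rw [e1, e2, Fintype.sum_prod_type]
  refine Finset.sum_congr rfl fun z _ => ?_
  rw [Finset.sum_eq_single y (fun b _ hb => by simp [hb]) (by simp), if_pos rfl, mul_one]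
  -- The path `z` is extended by `y`, so its value at time `k + 1` is exactly the next state tested.
  have hm := h.markov k (fun j => if hj : j < k + 1 then z ⟨j, hj⟩ else y)
  have s1 : {ω | ((fun i : Fin (k + 1) => Y i ω), Y (k + 1) ω) = (z, y)} =
      {ω | ∀ i ≤ k + 1, Y i ω = if hj : i < k + 1 then z ⟨i, hj⟩ else y} := by
    ext ω
    simp only [Set.mem_ofPred_eq, Prod.mk.injEq, funext_iff]
    constructor
    · rintro ⟨h1, h2⟩ i hi
      split_ifs with hj
      · exact h1 ⟨i, hj⟩
      · rw [show i = k + 1 by omega, h2]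
    · intro h1
      refine ⟨fun i => ?_, ?_⟩
      · have := h1 i i.2.le
        rwa [dif_pos i.2] at this
      · have := h1 (k + 1) le_rfl
        rwa [dif_neg (lt_irrefl _)] at this
  have s2 : {ω | (fun i : Fin (k + 1) => Y i ω) = z} =
      {ω | ∀ i ≤ k, Y i ω = if hj : i < k + 1 then z ⟨i, hj⟩ else y} := by
    ext ω
    simp only [Set.mem_ofPred_eq, funext_iff]
    constructor
    · intro h1 i hi
      rw [dif_pos (Nat.lt_succ_of_le hi)]
      exact h1 ⟨i, _⟩
    · intro h1 i
      have := h1 i (Nat.le_of_lt_succ i.2)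
      rwa [dif_pos i.2] at this
  rw [s1, s2, hm, dif_pos (Nat.lt_succ_self k), dif_neg (lt_irrefl _)]
  push_cast
  have : (⟨k, Nat.lt_succ_self k⟩ : Fin (k + 1)) = Fin.last k := rfl
  rw [this]
  ring

/-- The weighted law of `Y k`, with the weights `u_j (Y_j)` for `j < k`, has density
`chainState A u k` with respect to `μ`. -/
theorem IsStationaryReversibleMarkovChain.integral_prod_mul_ite [IsProbabilityMeasure P]
    (h : IsStationaryReversibleMarkovChain P A μ Y) (u : ℕ → Fin N → ℂ) (k : ℕ) (y : Fin N) :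
    ∫ ω, (∏ j ∈ Finset.range k, u j (Y j ω)) * (if Y k ω = y then 1 else 0) ∂P =
      μ y * chainState A u k y := by
  induction k generalizing y with
  | zero =>
    have := integral_comp_eq_sum (P := P) (h.measurable 0) (fun z => if z = y then (1 : ℂ) else 0)
    simpa [chainState, h.initial] using this
  | succ k ih =>
    have h1 := h.integral_mul_ite k (fun z => ∏ j : Fin (k + 1), u j (z j)) y
    simp only [Finset.prod_range]
    rw [h1]
    have h2 : ∀ ω, (∏ j : Fin (k + 1), u j (Y j ω)) * (A (Y k ω) y : ℂ) =
        ∑ z, (∏ j ∈ Finset.range k, u j (Y j ω)) * (if Y k ω = z then 1 else 0) *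
          (u k z * A z y) := by
      intro ω
      rw [Finset.sum_eq_single (Y k ω) (fun b _ hb => by simp [hb.symm]) (by simp), if_pos rfl,
        mul_one, ← Finset.prod_range (fun j => u j (Y j ω)), Finset.prod_range_succ, mul_assoc]
    simp_rw [h2]
    have hint : ∀ z, Integrable (fun ω => (∏ j ∈ Finset.range k, u j (Y j ω)) *
        (if Y k ω = z then 1 else 0) * (u k z * A z y)) P := by
      intro z
      have hZ : Measurable fun ω => fun i : Fin (k + 1) => Y i ω :=
        measurable_pi_lambda _ fun i => h.measurable i
      have := (Integrable.of_finite (μ := P.map fun ω => fun i : Fin (k + 1) => Y i ω)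
        (f := fun x => (∏ j : Fin k, u j (x j.castSucc)) *
          (if x (Fin.last k) = z then 1 else 0) * (u k z * A z y))).comp_measurable hZ
      refine this.congr (Filter.Eventually.of_forall fun ω => ?_)
      simp [Finset.prod_range]
    rw [integral_finsetSum _ fun z _ => hint z]
    simp_rw [integral_mul_const, ih]
    rw [chainState, chainOp_apply, Finset.mul_sum]
    refine Finset.sum_congr rfl fun z _ => ?_
    -- Detailed balance turns the transpose action on measures into the action of `A` on densities.
    have hrev : (μ z : ℂ) * A z y = μ y * A y z := by exact_mod_cast h.reversible z y
    rw [Pi.mul_apply]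
    linear_combination (chainState A u k z * u k z) * hrev

theorem IsStationaryReversibleMarkovChain.integral_prod [IsProbabilityMeasure P]
    (h : IsStationaryReversibleMarkovChain P A μ Y) (u : ℕ → Fin N → ℂ) (k : ℕ) :
    ∫ ω, ∏ j ∈ Finset.range k, u j (Y j ω) ∂P = wmean μ (chainState A u k) := by
  have h2 : ∀ ω, ∏ j ∈ Finset.range k, u j (Y j ω) =
      ∑ z, (∏ j ∈ Finset.range k, u j (Y j ω)) * (if Y k ω = z then 1 else 0) := by
    intro ω
    simp
  rw [integral_congr_ae (Filter.Eventually.of_forall h2), integral_finsetSum]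
  · simp_rw [h.integral_prod_mul_ite u k]
    rfl
  · intro z _
    have hZ : Measurable fun ω => fun i : Fin (k + 1) => Y i ω :=
      measurable_pi_lambda _ fun i => h.measurable i
    have := (Integrable.of_finite (μ := P.map fun ω => fun i : Fin (k + 1) => Y i ω)
      (f := fun x => (∏ j : Fin k, u j (x j.castSucc)) *
        (if x (Fin.last k) = z then (1 : ℂ) else 0))).comp_measurable hZ
    refine this.congr (Filter.Eventually.of_forall fun ω => ?_)
    simp [Finset.prod_range]

/-- Every `Y k` has law `μ`. -/
theorem IsStationaryReversibleMarkovChain.measureReal_eq [IsProbabilityMeasure P]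
    (h : IsStationaryReversibleMarkovChain P A μ Y) (k : ℕ) (y : Fin N) :
    P.real {ω | Y k ω = y} = μ y := by
  -- With all weights equal to 1 the density remains 1.
  have hs : ∀ k, chainState A (fun _ _ => 1) k = Function.const (Fin N) 1 := by
    intro k
    induction k with
    | zero => rfl
    | succ k ih =>
      have e : (fun _ => 1) * Function.const (Fin N) (1 : ℂ) = Function.const (Fin N) 1 := by
        ext i; simp
      rw [chainState, ih, e, h.isReversibleStochastic.chainOp_const]
  have h1 := h.integral_prod_mul_ite (fun _ _ => 1) k y
  have h2 := integral_comp_eq_sum (P := P) (h.measurable k)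
    (fun z => if z = y then (1 : ℂ) else 0)
  simp only [Finset.prod_const_one, one_mul, hs, Function.const_apply, mul_one] at h1
  rw [h1] at h2
  simp only [mul_ite, mul_one, mul_zero, Finset.sum_ite_eq', Finset.mem_univ, if_true] at h2
  exact_mod_cast h2.symm

theorem IsStationaryReversibleMarkovChain.sum_eq_zero [IsProbabilityMeasure P]
    (h : IsStationaryReversibleMarkovChain P A μ Y) {k : ℕ} {g : Fin N → ℤ}
    (hg : ∫ ω, (g (Y k ω) : ℝ) ∂P = 0) : ∑ y, (μ y : ℂ) * g y = 0 := by
  have h1 := integral_comp_eq_sum (P := P) (h.measurable k) (fun z => (g z : ℂ))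
  simp_rw [h.measureReal_eq k] at h1
  rw [← h1]
  have h2 : ∀ ω, (g (Y k ω) : ℂ) = ((g (Y k ω) : ℝ) : ℂ) := fun ω => by push_cast; rfl
  simp_rw [h2]
  rw [integral_complex_ofReal, hg, Complex.ofReal_zero]

end Chain

/-! ### Characteristic function and Fourier inversion -/

theorem stdAddChar_intCast_mul {p : ℕ} [NeZero p] {s : ℤ} (hs : s = -1 ∨ s = 1) (x : ZMod p) :
    (ZMod.stdAddChar ((s : ZMod p) * x) : ℂ) =
      (ZMod.stdAddChar x : ℂ).re + (s : ℂ) * ((ZMod.stdAddChar x : ℂ).im * Complex.I) := by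
  rcases hs with rfl | rfl
  · have h : ((-1 : ℤ) : ZMod p) * x = -x := by push_cast; ring
    rw [h, AddChar.map_neg_eq_conj]
    apply Complex.ext <;> simp
  · have h : ((1 : ℤ) : ZMod p) * x = x := by push_cast; ring
    rw [h]
    apply Complex.ext <;> simp

/-- Cosine is even and sine is odd, so a sign `g` multiplies only the sine part, which vanishes
because `g` has mean zero. -/
theorem wmean_stdAddChar {p N : ℕ} [NeZero p] {μ : Fin N → ℝ} (hμ1 : ∑ i, μ i = 1)
    {g : Fin N → ℤ} (hg : ∀ y, g y = -1 ∨ g y = 1) (hg0 : ∑ y, (μ y : ℂ) * g y = 0)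
    (x : ZMod p) :
    wmean μ (fun y => (ZMod.stdAddChar ((g y : ZMod p) * x) : ℂ)) =
      (ZMod.stdAddChar x : ℂ).re := by
  simp only [wmean, stdAddChar_intCast_mul (hg _), mul_add, ← mul_assoc]
  rw [Finset.sum_add_distrib]
  simp_rw [mul_assoc]
  simp only [← mul_assoc]
  rw [← Finset.sum_mul, ← Finset.sum_mul, ← Finset.sum_mul, hg0, ← Complex.ofReal_sum, hμ1]
  simp

theorem stdAddChar_sum {p : ℕ} [NeZero p] {ι : Type*} (s : Finset ι) (x : ι → ZMod p) :
    (ZMod.stdAddChar (∑ i ∈ s, x i) : ℂ) = ∏ i ∈ s, (ZMod.stdAddChar (x i) : ℂ) := by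
  classical
  induction s using Finset.induction_on with
  | empty => simp
  | insert a s ha ih => rw [Finset.sum_insert ha, Finset.prod_insert ha, AddChar.map_add_eq_mul, ih]

/-- A pointwise Fourier bound for the sum of a Markov chain. -/
theorem IsStationaryReversibleMarkovChain.norm_integral_stdAddChar_le {n N p : ℕ} [NeZero p]
    {Ω : Type*} [MeasurableSpace Ω] {P : Measure Ω} [IsProbabilityMeasure P]
    {A : Matrix (Fin N) (Fin N) ℝ} {μ : Fin N → ℝ} {Y : ℕ → Ω → Fin N}
    {f : Fin n → Fin N → ℤ} (v : Fin n → ZMod p)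
    (h : IsStationaryReversibleMarkovChain P A μ Y) (hlt : chainLambda A μ ≤ 1)
    (hf : ∀ i y, f i y = -1 ∨ f i y = 1)
    (hf0 : ∀ i : Fin n, ∫ ω, (f i (Y i ω) : ℝ) ∂P = 0) (ξ : ZMod p) :
    ‖∫ ω, (ZMod.stdAddChar (ξ * ∑ i : Fin n, (f i (Y i ω) : ZMod p) * v i) : ℂ) ∂P‖ ≤
      Real.exp (-((1 - chainLambda A μ) ^ 2 / 2) *
        sineEnergy (fun i : Fin (n / 2) => v ⟨2 * i + 1, by omega⟩) ξ) := by
  let u : ℕ → Fin N → ℂ := fun j y =>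
    if hj : j < n then (ZMod.stdAddChar ((f ⟨j, hj⟩ y : ZMod p) * (ξ * v ⟨j, hj⟩)) : ℂ) else 1
  have hu : ∀ k i, ‖u k i‖ ≤ 1 := by
    intro k i
    simp only [u]
    split_ifs
    · rw [AddChar.norm_apply]
    · simp
  have h1 : ∀ ω, (ZMod.stdAddChar (ξ * ∑ i : Fin n, (f i (Y i ω) : ZMod p) * v i) : ℂ) =
      ∏ j ∈ Finset.range n, u j (Y j ω) := by
    intro ω
    rw [Finset.prod_range, Finset.mul_sum, stdAddChar_sum]
    refine Finset.prod_congr rfl fun i _ => ?_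
    simp only [u, dif_pos i.2]
    congr 1; ring
  simp_rw [h1]
  rw [h.integral_prod]
  refine (h.isReversibleStochastic.norm_wmean_chainState_le hlt hu n).trans ?_
  rw [sineEnergy, Finset.mul_sum, Real.exp_sum, Finset.prod_range]
  refine Finset.prod_le_prod (fun i _ => ?_) fun i _ => ?_
  · have hl0 : 0 ≤ chainLambda A μ := IsReversibleStochastic.chainLambda_nonneg A μ
    have hq : (1 - chainLambda A μ) ^ 2 ≤ 1 := pow_le_one₀ (sub_nonneg.2 hlt) (by linarith)
    have : 0 ≤ ‖wmean μ (u (2 * i + 1))‖ := norm_nonneg _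
    nlinarith [sq_nonneg (1 - chainLambda A μ)]
  · have hi : 2 * (i : ℕ) + 1 < n := by omega
    have hw : wmean μ (u (2 * i + 1)) = (ZMod.stdAddChar (ξ * v ⟨2 * i + 1, hi⟩) : ℂ).re := by
      have : u (2 * i + 1) = fun y => (ZMod.stdAddChar
          ((f ⟨2 * i + 1, hi⟩ y : ZMod p) * (ξ * v ⟨2 * i + 1, hi⟩)) : ℂ) := by
        ext y; simp only [u, dif_pos hi]
      rw [this]
      exact wmean_stdAddChar h.stationary_sum (hf _) (h.sum_eq_zero (hf0 ⟨2 * i + 1, hi⟩)) _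
    rw [hw, Complex.norm_real, Real.norm_eq_abs]
    generalize hz : (ZMod.stdAddChar (ξ * v ⟨2 * i + 1, hi⟩) : ℂ) = z
    have hz1 : z.re * z.re + z.im * z.im = 1 := by
      rw [← Complex.normSq_apply, Complex.normSq_eq_norm_sq, ← hz, AddChar.norm_apply, one_pow]
    -- With `c = |z.re|`, this is `(1 - c²) / 2 ≤ 1 - c`, that is `(1 - c)² ≥ 0`.
    have h3 : z.im ^ 2 / 2 ≤ 1 - |z.re| := by
      nlinarith [sq_nonneg (1 - |z.re|), sq_abs z.re]
    have h4 := Real.add_one_le_exp (-((1 - chainLambda A μ) ^ 2 / 2) * z.im ^ 2)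
    have h5 := mul_le_mul_of_nonneg_left h3 (sq_nonneg (1 - chainLambda A μ))
    linarith

/-- Fourier inversion modulo `p` bounds point probabilities. -/
theorem measureReal_eq_le_sum_norm {p : ℕ} [NeZero p] {Ω : Type*} [MeasurableSpace Ω]
    {P : Measure Ω} [IsProbabilityMeasure P] {S : Ω → ℤ} (hS : Measurable S) (x : ℤ) :
    P.real {ω | S ω = x} ≤
      (p : ℝ)⁻¹ * ∑ ξ : ZMod p, ‖∫ ω, (ZMod.stdAddChar (ξ * (S ω : ZMod p)) : ℂ) ∂P‖ := by
  have hp : (0 : ℝ) < p := by exact_mod_cast Nat.pos_of_ne_zero (NeZero.ne p)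
  have hT : Measurable fun ω => (S ω : ZMod p) := (measurable_from_top (f := Int.cast)).comp hS
  set T : Ω → ZMod p := fun ω => (S ω : ZMod p)
  have hms : MeasurableSet {ω | T ω = (x : ZMod p)} := hT (measurableSet_singleton _)
  have h1 : P.real {ω | S ω = x} ≤ P.real {ω | T ω = (x : ZMod p)} :=
    measureReal_mono fun ω (hω : S ω = x) => by simp [T, hω]
  refine h1.trans ?_
  have hint : ∀ ξ : ZMod p, Integrable
      (fun ω => (ZMod.stdAddChar (ξ * T ω) : ℂ) * ZMod.stdAddChar (-(ξ * (x : ZMod p)))) P := by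
    intro ξ
    exact (Integrable.of_finite (μ := P.map T) (f := fun t : ZMod p =>
      (ZMod.stdAddChar (ξ * t) : ℂ) * ZMod.stdAddChar (-(ξ * (x : ZMod p))))).comp_measurable hT
  have h2 : ∀ ω, (p : ℂ) * Set.indicator {ω | T ω = (x : ZMod p)} (fun _ => (1 : ℂ)) ω =
      ∑ ξ : ZMod p, (ZMod.stdAddChar (ξ * T ω) : ℂ) * ZMod.stdAddChar (-(ξ * (x : ZMod p))) := by
    intro ω
    have e : ∀ ξ : ZMod p, (ZMod.stdAddChar (ξ * T ω) : ℂ) *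
        ZMod.stdAddChar (-(ξ * (x : ZMod p))) = ZMod.stdAddChar (ξ * (T ω - (x : ZMod p))) := by
      intro ξ
      rw [← AddChar.map_add_eq_mul]
      congr 1; ring
    simp_rw [e]
    rw [AddChar.sum_mulShift _ (ZMod.isPrimitive_stdAddChar p), ZMod.card]
    by_cases hω : T ω = (x : ZMod p)
    · simp [hω]
    · simp [hω, sub_eq_zero]
  have h3 : (p : ℂ) * P.real {ω | T ω = (x : ZMod p)} =
      ∑ ξ : ZMod p, (∫ ω, (ZMod.stdAddChar (ξ * T ω) : ℂ) ∂P) *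
        ZMod.stdAddChar (-(ξ * (x : ZMod p))) := by
    simp_rw [← integral_mul_const]
    rw [← integral_finsetSum _ fun ξ _ => hint ξ]
    simp_rw [← h2]
    rw [integral_const_mul, integral_indicator_const _ hms, Complex.real_smul, mul_one]
  have h4 := congrArg norm h3
  rw [norm_mul, Complex.norm_natCast, Complex.norm_real, Real.norm_of_nonneg measureReal_nonneg]
    at h4
  rw [le_inv_mul_iff₀ hp, h4]
  refine (norm_sum_le _ _).trans_eq (Finset.sum_congr rfl fun ξ _ => ?_)
  rw [norm_mul, AddChar.norm_apply, mul_one]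

/-! ### Conclusion -/

theorem theorem2 :
    ∃ C : ℝ, 0 < C ∧
      ∀ (n N : ℕ) (Ω : Type*) [MeasurableSpace Ω] (P : MeasureTheory.Measure Ω)
        [MeasureTheory.IsProbabilityMeasure P]
        (A : Matrix (Fin N) (Fin N) ℝ) (μ : Fin N → ℝ) (Y : ℕ → Ω → Fin N)
        (f : Fin n → Fin N → ℤ) (v : Fin n → ℤ) (x₀ : ℤ),
        1 ≤ n →
        IsStationaryReversibleMarkovChain P A μ Y →
        chainLambda A μ < 1 →
        (∀ i y, f i y = -1 ∨ f i y = 1) →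
        (∀ i : Fin n, ∫ ω, (f i (Y i ω) : ℝ) ∂P = 0) →
        (∀ i, 1 ≤ v i) →
        Function.Injective v →
        P.real {ω | ∑ i : Fin n, f i (Y i ω) * v i = x₀} ≤
          C / ((1 - chainLambda A μ) ^ 3 * (n : ℝ) ^ (3 / 2 : ℝ)) := by
  have hK := layerConst_nonneg
  -- The 1 pays for the zero frequency and for `n = 1`; `144 = 16 * 9`, where 9 is the cost of
  -- replacing `n / 2` by `n`.
  refine ⟨1 + 144 * layerConst, by positivity, ?_⟩
  intro n N Ω _ P _ A μ Y f v x₀ hn h hlt hf hf0 hv1 hv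
  have hl0 : 0 ≤ chainLambda A μ := IsReversibleStochastic.chainLambda_nonneg A μ
  set a := 1 - chainLambda A μ with ha
  have ha0 : 0 < a := sub_pos.2 hlt
  have ha1 : a ≤ 1 := by linarith
  have ha3 : a ^ 3 ≤ 1 := pow_le_one₀ ha0.le ha1
  have hn0 : (0 : ℝ) < n := by exact_mod_cast hn
  have hpow : (n : ℝ) ^ (3 / 2 : ℝ) = n * √n := by
    rw [show (3 / 2 : ℝ) = 1 + 1 / 2 by norm_num, Real.rpow_add hn0, Real.rpow_one,
      Real.sqrt_eq_rpow]
  rw [hpow]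
  rcases hn.eq_or_lt with rfl | hn2
  · refine measureReal_le_one.trans ?_
    rw [one_le_div (by positivity)]
    simp only [Nat.cast_one, Real.sqrt_one, mul_one]
    linarith
  have hm : 0 < n / 2 := Nat.div_pos hn2 two_pos
  have : Nonempty (Fin (n / 2)) := ⟨⟨0, hm⟩⟩
  -- The term `n ^ 2` makes `1 / p` negligible, `3` excludes `p = 2`, and the sum keeps the
  -- coefficients distinct modulo `p`.
  obtain ⟨p, hp, hpp⟩ := Nat.exists_infinite_primes (n ^ 2 + 3 + ∑ i, (v i).toNat)
  have : Fact p.Prime := ⟨hpp⟩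
  have hvp : ∀ i, v i < p := by
    intro i
    have h1 : (v i).toNat ≤ ∑ i, (v i).toNat :=
      Finset.single_le_sum (f := fun i => (v i).toNat) (fun _ _ => Nat.zero_le _)
        (Finset.mem_univ i)
    have := hv1 i
    omega
  have hinj : Function.Injective fun i : Fin (n / 2) =>
      ((v ⟨2 * i + 1, by omega⟩ : ℤ) : ZMod p) := by
    intro i j hij
    have h1 := (ZMod.intCast_eq_intCast_iff' _ _ p).1 hij
    rw [Int.emod_eq_of_lt (zero_le_one.trans (hv1 _)) (hvp _),
      Int.emod_eq_of_lt (zero_le_one.trans (hv1 _)) (hvp _)] at h1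
    have h2 := hv h1
    simp only [Fin.mk.injEq] at h2
    exact Fin.ext (by omega)
  have hmeas : Measurable fun ω => ∑ i : Fin n, f i (Y i ω) * v i := by
    refine Finset.measurable_sum _ fun i _ => ?_
    exact (measurable_of_finite fun y => f i y * v i).comp (h.measurable i)
  have hF := measureReal_eq_le_sum_norm (p := p) (P := P) hmeas x₀
  have hE : ∀ ξ : ZMod p, ‖∫ ω, (ZMod.stdAddChar
      (ξ * ((∑ i : Fin n, f i (Y i ω) * v i : ℤ) : ZMod p)) : ℂ) ∂P‖ ≤
      Real.exp (-(a ^ 2 / 2) * sineEnergy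
        (fun i : Fin (n / 2) => ((v ⟨2 * i + 1, by omega⟩ : ℤ) : ZMod p)) ξ) := by
    intro ξ
    have := h.norm_integral_stdAddChar_le (fun i => (v i : ZMod p)) hlt.le hf hf0 ξ
    push_cast
    exact this
  have hH := sum_exp_neg_sineEnergy_le (by omega) hinj ha0 ha1
  have hp0 : (0 : ℝ) < p := by exact_mod_cast hpp.pos
  rw [Fintype.card_fin] at hH
  have hm3 : (n : ℝ) ≤ 3 * (n / 2 : ℕ) := by
    have : n ≤ 3 * (n / 2) := by omega
    exact_mod_cast this
  have hm0 : (0 : ℝ) < (n / 2 : ℕ) := by exact_mod_cast hm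
  have hD : (n : ℝ) * √n ≤ 9 * ((n / 2 : ℕ) * √(n / 2 : ℕ)) := by
    have hs : √(n : ℝ) ≤ 3 * √(n / 2 : ℕ) := by
      rw [Real.sqrt_le_left (by positivity), mul_pow, Real.sq_sqrt hm0.le]
      linarith
    calc (n : ℝ) * √n ≤ (3 * (n / 2 : ℕ)) * (3 * √(n / 2 : ℕ)) := by gcongr
      _ = _ := by ring
  have hnp : (n : ℝ) * √n ≤ p := by
    have h1 : √(n : ℝ) ≤ n := Real.sqrt_le_self_iff.2 (Or.inr (by exact_mod_cast hn))
    have h2 : ((n ^ 2 : ℕ) : ℝ) ≤ p := by exact_mod_cast (by omega : n ^ 2 ≤ p)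
    push_cast at h2
    nlinarith
  have hs0 : 0 < (n : ℝ) * √n := by positivity
  calc P.real {ω | ∑ i : Fin n, f i (Y i ω) * v i = x₀}
      ≤ (p : ℝ)⁻¹ * (1 + 16 * layerConst * p / (a ^ 3 * ((n / 2 : ℕ) * √(n / 2 : ℕ)))) :=
        hF.trans (mul_le_mul_of_nonneg_left
          ((Finset.sum_le_sum fun ξ _ => hE ξ).trans hH) (by positivity))
    _ = (p : ℝ)⁻¹ + 16 * layerConst / (a ^ 3 * ((n / 2 : ℕ) * √(n / 2 : ℕ))) := by
        field_simp
    _ ≤ 1 / (a ^ 3 * (n * √n)) + 144 * layerConst / (a ^ 3 * (n * √n)) := by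
        refine add_le_add ?_ ?_
        · rw [inv_eq_one_div]
          refine one_div_le_one_div_of_le (by positivity) ?_
          exact (mul_le_of_le_one_left hs0.le ha3).trans hnp
        · rw [div_le_div_iff₀ (by positivity) (by positivity)]
          calc 16 * layerConst * (a ^ 3 * (n * √n))
              ≤ 16 * layerConst * (a ^ 3 * (9 * ((n / 2 : ℕ) * √(n / 2 : ℕ)))) := by gcongr
            _ = _ := by ring
    _ = (1 + 144 * layerConst) / (a ^ 3 * (n * √n)) := by rw [← add_div]
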